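/- Let $n\in\mathbb N$ and write permutations of $[n]=\{1,\dots,n\}$ as $\sigma=\sigma_1\dots\sigma_n\in\mathfrak S_n$. Order $\mathfrak S_n$ by the weak order: $\sigma\le\tau$ iff $\mathrm{inv}(\sigma)\subseteq\mathrm{inv}(\tau)$, where $\mathrm{inv}(\sigma)=\{(\sigma_i,\sigma_j): i<j,\ \sigma_i>\sigma_j\}$; this is a lattice. Write $]a,b[\,=\{a+1,\dots,b-1\}$. An arc is a quadruple $(a,b,n,S)$ with $1\le a<b\le n$ and $S\subseteq\,]a,b[$. A set $I$ of arcs is an arc ideal if $(a,d,n,S)\in I$ implies $(b,c,n,S\cap\,]b,c[)\in I$ for all $a\le b<c\le d$. Two arcs $(a,b,n,R)$ and $(c,d,n,S)$ cross if there are $r,s\in([a,b]\cap[c,d])\smallsetminus(\{a,b\}\cap\{c,d\})$ with $r\in(R\cup\{a,b\})\smallsetminus S$ and $s\in(S\cup\{c,d\})\smallsetminus R$. A noncrossing arc diagram is a set of arcs such that any two distinct arcs of it do not cross, have distinct left endpoints and have distinct right endpoints. For positions $i<j$ with $\sigma_i>\sigma_j$ put $$\alpha(i,j,\sigma)=\bigl(\sigma_j,\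 \sigma_i,\ n,\ \{\sigma_k : k<i,\ \sigma_k\in\,]\sigma_j,\sigma_i[\,\}\bigr),\qquad \delta(\sigma)=\{\alpha(i,i+1,\sigma) : \sigma_i>\sigma_{i+1}\}.$$ Let $\equiv$ be a lattice congruence of the weak order on $\mathfrak S_n$. Let $\pi_\downarrow(\sigma)$ be the minimum of the $\equiv$-class of $\sigma$, and let $I=I_\equiv$ be the set of arcs corresponding to the join-irreducible permutations $\sigma$ with $\pi_\downarrow(\sigma)=\sigma$, where a join-irreducible permutation corresponds to the arc of its unique descent. The noncrossing arc diagram of $I$ corresponding to the class of $\sigma$ is $\eta_I(\sigma)=\delta(\pi_\downarrow(\sigma))$. Let $B(\sigma)$ be the set of pairs $(i,j)$ with $1\le i<j\le n$, $\sigma_i>\sigma_j$ and $\sigma(]i,j[)\cap\,]\sigma_j,\sigma_i[\,=\varnothing$, ordered by $(i,j)\prec(k,\ell)$ iff $i\le k<\ell\le j$ and $\sigma_k\ge\sigma_i>\sigma_j\ge\sigma_\ell$. Let $B_I(\sigma)$ be the set of $\prec$-maximal elements of $\{(i,j)\in B(\sigma) : \alpha(i,j,\sigma)\in I\}$. Then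 $I$ is an arc ideal, and for every $\sigma\in\mathfrak S_n$, $$\eta_I(\sigma)=\delta(\pi_\downarrow(\sigma))=\{\alpha(i,j,\sigma) : (i,j)\in B_I(\sigma)\},$$ and this set is a noncrossing arc diagram all of whose arcs lie in $I$. -/

import Mathlib

/-! Permutations of `[n]` are elements `σ : Equiv.Perm (Fin n)` in one-line notation: `σ i` is the
value at position `i`. Positions and values are numbered from `0` to `n - 1`. -/

namespace ArcDiagram

variable {n : ℕ}

/-- The inversion set of `σ`: the pairs of values `(σ i, σ j)` with `i < j` and `σ i > σ j`. -/
def inv (σ : Equiv.Perm (Fin n)) : Set (Fin n × Fin n) :=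
  {p | ∃ i j : Fin n, i < j ∧ σ j < σ i ∧ p = (σ i, σ j)}

theorem mem_inv {σ : Equiv.Perm (Fin n)} {b a : Fin n} :
    (b, a) ∈ inv σ ↔ a < b ∧ σ.symm b < σ.symm a := by
  constructor
  · rintro ⟨i, j, hij, h, hp⟩
    obtain ⟨rfl, rfl⟩ := Prod.mk.inj hp
    simpa using ⟨h, hij⟩
  · rintro ⟨h, h'⟩
    exact ⟨σ.symm b, σ.symm a, h', by simpa using h, by simp⟩

theorem inv_injective : Function.Injective (inv (n := n)) := by
  intro σ τ h
  have key : ∀ x y : Fin n, σ.symm x < σ.symm y → τ.symm x < τ.symm y := by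
    intro x y hxy
    rcases lt_trichotomy x y with hlt | rfl | hgt
    · by_contra hcon
      have hne : τ.symm y ≠ τ.symm x := fun e => hlt.ne (τ.symm.injective e).symm
      have h1 : (y, x) ∈ inv τ := mem_inv.2 ⟨hlt, lt_of_le_of_ne (not_lt.1 hcon) hne⟩
      rw [← h] at h1
      exact lt_asymm hxy (mem_inv.1 h1).2
    · exact absurd hxy (lt_irrefl _)
    · have h1 : (x, y) ∈ inv σ := mem_inv.2 ⟨hgt, hxy⟩
      rw [h] at h1
      exact (mem_inv.1 h1).2
  have hm : StrictMono (fun i : Fin n => τ.symm (σ i)) := by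
    intro i j hij
    exact key _ _ (by simpa using hij)
  let e : Fin n ≃o Fin n := hm.orderIsoOfSurjective _ (by
    intro y
    exact ⟨σ.symm (τ y), by simp⟩)
  ext i
  have h1 : e i = i := by rw [Subsingleton.elim e (OrderIso.refl _)]; rfl
  have h2 : τ.symm (σ i) = i := h1
  rw [Equiv.symm_apply_eq] at h2
  rw [h2]

/-- The weak order: inclusion of inversion sets. -/
instance weakOrder : PartialOrder (Equiv.Perm (Fin n)) :=
  PartialOrder.lift inv inv_injective

theorem le_iff_inv {σ τ : Equiv.Perm (Fin n)} : σ ≤ τ ↔ inv σ ⊆ inv τ := Iff.rfl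

/-- A transitive and cotransitive set of decreasing pairs is an inversion set. -/
theorem exists_inv_eq (T : Set (Fin n × Fin n)) (hT : ∀ a b, (b, a) ∈ T → a < b)
    (htr : ∀ a b c, (c, b) ∈ T → (b, a) ∈ T → (c, a) ∈ T)
    (hco : ∀ a b c, a < b → b < c → (c, a) ∈ T → (c, b) ∈ T ∨ (b, a) ∈ T) :
    ∃ σ : Equiv.Perm (Fin n), inv σ = T := by
  classical
  -- `B x y`: the value `x` is to be placed before the value `y`
  let B : Fin n → Fin n → Prop := fun x y => (x < y ∧ (y, x) ∉ T) ∨ (x, y) ∈ T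
  have Birr : ∀ x, ¬ B x x := by
    rintro x (h | h)
    · exact lt_irrefl _ h.1
    · exact lt_irrefl _ (hT _ _ h)
  have Btot : ∀ x y, x ≠ y → B x y ∨ B y x := by
    intro x y hxy
    rcases lt_or_gt_of_ne hxy with h | h
    · by_cases h' : (y, x) ∈ T
      · exact Or.inr (Or.inr h')
      · exact Or.inl (Or.inl ⟨h, h'⟩)
    · by_cases h' : (x, y) ∈ T
      · exact Or.inl (Or.inr h')
      · exact Or.inr (Or.inl ⟨h, h'⟩)
  have Btr : ∀ x y z, B x y → B y z → B x z := by
    rintro x y z (⟨h1, h2⟩ | h1) (⟨h3, h4⟩ | h3)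
    · exact Or.inl ⟨h1.trans h3, fun h => (hco x y z h1 h3 h).elim h4 h2⟩
    · have hzy := hT _ _ h3
      rcases lt_trichotomy x z with h | rfl | h
      · exact Or.inl ⟨h, fun h' => h2 (htr _ _ _ h3 h')⟩
      · exact absurd h3 h2
      · exact Or.inr ((hco z x y h h1 h3).resolve_left h2)
    · have hyx := hT _ _ h1
      rcases lt_trichotomy x z with h | rfl | h
      · exact Or.inl ⟨h, fun h' => h4 (htr _ _ _ h' h1)⟩
      · exact absurd h1 h4
      · exact Or.inr ((hco y z x h3 h h1).resolve_right h4)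
    · exact Or.inr (htr _ _ _ h1 h3)
  -- the position of the value `x` is the number of values before it
  let c : Fin n → ℕ := fun x => (Finset.univ.filter (fun y => B y x)).card
  have hmono : ∀ x y, B x y → c x < c y := by
    intro x y h
    apply Finset.card_lt_card
    rw [Finset.ssubset_iff_of_subset]
    · exact ⟨x, by simpa using h, by simpa using Birr x⟩
    · intro z hz
      simp only [Finset.mem_filter, Finset.mem_univ, true_and] at hz ⊢
      exact Btr _ _ _ hz h
  have hlt : ∀ x, c x < n := by
    intro x
    have h1 : c x < (Finset.univ : Finset (Fin n)).card := by
      apply Finset.card_lt_card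
      rw [Finset.ssubset_iff_of_subset (Finset.subset_univ _)]
      exact ⟨x, Finset.mem_univ _, by simpa using Birr x⟩
    simpa using h1
  let p : Fin n → Fin n := fun x => ⟨c x, hlt x⟩
  have hinj : Function.Injective p := by
    intro x y hxy
    by_contra hne
    have e : c x = c y := congrArg Fin.val hxy
    rcases Btot x y hne with h | h
    · exact absurd e (hmono _ _ h).ne
    · exact absurd e (hmono _ _ h).ne'
  let e : Equiv.Perm (Fin n) := Equiv.ofBijective p (Finite.injective_iff_bijective.1 hinj)
  have hiff : ∀ x y, p x < p y ↔ B x y := by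
    intro x y
    refine ⟨fun h => ?_, fun h => hmono _ _ h⟩
    have hne : x ≠ y := by rintro rfl; exact lt_irrefl _ h
    exact (Btot x y hne).resolve_right (fun h' => lt_asymm h (hmono _ _ h'))
  refine ⟨e.symm, ?_⟩
  ext ⟨b, a⟩
  rw [mem_inv]
  change a < b ∧ p b < p a ↔ _
  rw [hiff]
  constructor
  · rintro ⟨h, h' | h'⟩
    · exact absurd h'.1 (lt_asymm h)
    · exact h'
  · intro h
    exact ⟨hT _ _ h, Or.inr h⟩

theorem inv_trans (σ : Equiv.Perm (Fin n)) {a b c : Fin n} (h : (c, b) ∈ inv σ)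
    (h' : (b, a) ∈ inv σ) : (c, a) ∈ inv σ := by
  rw [mem_inv] at *
  exact ⟨h'.1.trans h.1, h.2.trans h'.2⟩

theorem inv_cotrans (σ : Equiv.Perm (Fin n)) {a b c : Fin n} (hab : a < b) (hbc : b < c)
    (h : (c, a) ∈ inv σ) : (c, b) ∈ inv σ ∨ (b, a) ∈ inv σ := by
  rw [mem_inv] at h
  rw [mem_inv, mem_inv]
  rcases lt_or_ge (σ.symm c) (σ.symm b) with h1 | h1
  · exact Or.inl ⟨hbc, h1⟩
  · exact Or.inr ⟨hab, h1.trans_lt h.2⟩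

theorem exists_isLUB (σ τ : Equiv.Perm (Fin n)) : ∃ ρ, IsLUB {σ, τ} ρ := by
  let R : Fin n → Fin n → Prop := fun x y => (x, y) ∈ inv σ ∨ (x, y) ∈ inv τ
  have hR : ∀ x y, R x y → y < x := by
    rintro x y (h | h)
    · exact (mem_inv.1 h).1
    · exact (mem_inv.1 h).1
  have hRco : ∀ a b c, a < b → b < c → R c a → R c b ∨ R b a := by
    rintro a b c hab hbc (h | h)
    · exact (inv_cotrans σ hab hbc h).imp Or.inl Or.inl
    · exact (inv_cotrans τ hab hbc h).imp Or.inr Or.inr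
  have hTlt : ∀ x y, Relation.TransGen R x y → y < x := by
    intro x y h
    induction h with
    | single h => exact hR _ _ h
    | tail _ h ih => exact (hR _ _ h).trans ih
  obtain ⟨ρ, hρ⟩ := exists_inv_eq {p : Fin n × Fin n | Relation.TransGen R p.1 p.2}
    (fun a b h => hTlt _ _ h) (fun a b c h h' => Relation.TransGen.trans h h') (by
      intro a b c hab hbc h
      change Relation.TransGen R c a at h
      change Relation.TransGen R c b ∨ Relation.TransGen R b a
      induction h with
      | single h =>
        exact (hRco _ _ _ hab hbc h).imp Relation.TransGen.single Relation.TransGen.single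
      | @tail d a hcd hda ih =>
        rcases lt_trichotomy d b with h | rfl | h
        · exact (ih h).imp id (fun h' => h'.tail hda)
        · exact Or.inl hcd
        · rcases hRco _ _ _ hab h hda with h' | h'
          · exact Or.inl (hcd.tail h')
          · exact Or.inr (Relation.TransGen.single h'))
  refine ⟨ρ, ?_, ?_⟩
  · rintro π (rfl | rfl)
    · rw [le_iff_inv, hρ]
      rintro ⟨x, y⟩ h
      exact Relation.TransGen.single (Or.inl h)
    · rw [le_iff_inv, hρ]
      rintro ⟨x, y⟩ h
      exact Relation.TransGen.single (Or.inr h)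
  · intro π hπ
    have h1 : inv σ ⊆ inv π := hπ (by simp)
    have h2 : inv τ ⊆ inv π := hπ (by simp)
    rw [le_iff_inv, hρ]
    rintro ⟨x, y⟩ h
    change Relation.TransGen R x y at h
    have hRπ : ∀ x y, R x y → (x, y) ∈ inv π := by
      rintro x y (h | h)
      · exact h1 h
      · exact h2 h
    induction h with
    | single h => exact hRπ _ _ h
    | tail _ h ih => exact inv_trans π ih (hRπ _ _ h)

/-- Composition with the longest permutation reverses the weak order. -/
theorem rev_le_rev {σ τ : Equiv.Perm (Fin n)} (h : σ ≤ τ) :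
    τ.trans Fin.revPerm ≤ σ.trans Fin.revPerm := by
  rw [le_iff_inv] at *
  rintro ⟨b, a⟩ hab
  rw [mem_inv] at *
  refine ⟨hab.1, ?_⟩
  have h1 : τ.symm b.rev < τ.symm a.rev := hab.2
  change σ.symm b.rev < σ.symm a.rev
  by_contra hcon
  have hlt : b.rev < a.rev := Fin.rev_lt_rev.2 hab.1
  have hne : σ.symm a.rev ≠ σ.symm b.rev := fun e => hlt.ne (σ.symm.injective e).symm
  have h2 : (a.rev, b.rev) ∈ inv τ := h (mem_inv.2 ⟨hlt, lt_of_le_of_ne (not_lt.1 hcon) hne⟩)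
  exact lt_asymm h1 (mem_inv.1 h2).2

theorem rev_rev (σ : Equiv.Perm (Fin n)) :
    (σ.trans Fin.revPerm).trans Fin.revPerm = σ := by
  ext i; simp

theorem exists_isGLB (σ τ : Equiv.Perm (Fin n)) : ∃ ρ, IsGLB {σ, τ} ρ := by
  obtain ⟨ρ, h1, h2⟩ := exists_isLUB (σ.trans Fin.revPerm) (τ.trans Fin.revPerm)
  refine ⟨ρ.trans Fin.revPerm, ?_, ?_⟩
  · rintro π (rfl | rfl)
    · have := rev_le_rev (h1 (Set.mem_insert _ _))
      rwa [rev_rev] at this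
    · have := rev_le_rev (h1 (Set.mem_insert_of_mem _ (Set.mem_singleton _)))
      rwa [rev_rev] at this
  · intro π hπ
    have h3 := rev_le_rev (h2 (a := π.trans Fin.revPerm) (by
      rintro _ (rfl | rfl)
      · exact rev_le_rev (hπ (by simp))
      · exact rev_le_rev (hπ (by simp))))
    rwa [rev_rev] at h3

/-- The weak order is a lattice. -/
noncomputable instance weakOrderLattice : Lattice (Equiv.Perm (Fin n)) :=
  { weakOrder with
    sup := fun σ τ => (exists_isLUB σ τ).choose
    le_sup_left := fun σ τ => (exists_isLUB σ τ).choose_spec.1 (by simp)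
    le_sup_right := fun σ τ => (exists_isLUB σ τ).choose_spec.1 (by simp)
    sup_le := fun σ τ ρ h h' => (exists_isLUB σ τ).choose_spec.2 (by
      rintro _ (rfl | rfl)
      · exact h
      · exact h')
    inf := fun σ τ => (exists_isGLB σ τ).choose
    inf_le_left := fun σ τ => (exists_isGLB σ τ).choose_spec.1 (by simp)
    inf_le_right := fun σ τ => (exists_isGLB σ τ).choose_spec.1 (by simp)
    le_inf := fun ρ σ τ h h' => (exists_isGLB σ τ).choose_spec.2 (by
      rintro _ (rfl | rfl)
      · exact h
      · exact h') }

/-- An arc `(a, b, n, S)`: `a < b` in `[n]` and `S ⊆ ]a, b[`. It is drawn from `a` to `b`, passing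
above the points of `S` and below the other points of `]a, b[`. -/
@[ext]
structure Arc (n : ℕ) where
  left : Fin n
  right : Fin n
  above : Set (Fin n)
  left_lt_right : left < right
  above_subset : above ⊆ Set.Ioo left right

/-- Two arcs `(a, b, n, R)` and `(c, d, n, S)` cross: among the points of `[a, b] ∩ [c, d]` that are
not a common endpoint, there are a point `r` where the first arc is above the second one (at `r`,
the first arc ends or passes above, the second one ends or passes below) and a point `s` where the
second arc is above the first one. -/
def Arc.Cross (α β : Arc n) : Prop :=
  ∃ r ∈ (Set.Icc α.left α.right ∩ Set.Icc β.left β.right) \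
      ({α.left, α.right} ∩ {β.left, β.right}),
  ∃ s ∈ (Set.Icc α.left α.right ∩ Set.Icc β.left β.right) \
      ({α.left, α.right} ∩ {β.left, β.right}),
    r ∈ (α.above ∪ {α.left, α.right}) \ β.above ∧ s ∈ (β.above ∪ {β.left, β.right}) \ α.above

/-- A noncrossing arc diagram: any two distinct arcs do not cross, have distinct left endpoints and
have distinct right endpoints. -/
def IsNoncrossingArcDiagram (D : Set (Arc n)) : Prop :=
  ∀ α ∈ D, ∀ β ∈ D, α ≠ β → ¬ α.Cross β ∧ α.left ≠ β.left ∧ α.right ≠ β.right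

/-- An arc ideal: a set of arcs containing, with `(a, d, n, S)`, all its restrictions
`(b, c, n, S ∩ ]b, c[)` for `a ≤ b < c ≤ d`. -/
def IsArcIdeal (I : Set (Arc n)) : Prop :=
  ∀ α ∈ I, ∀ β : Arc n, α.left ≤ β.left → β.right ≤ α.right →
    β.above = α.above ∩ Set.Ioo β.left β.right → β ∈ I

/-- The arc `α(i, j, σ) = (σ j, σ i, n, {σ k | k < i, σ k ∈ ]σ j, σ i[})`. -/
def arc (σ : Equiv.Perm (Fin n)) (i j : Fin n) (h : σ j < σ i) : Arc n where
  left := σ j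
  right := σ i
  above := {v | ∃ k : Fin n, k < i ∧ v = σ k} ∩ Set.Ioo (σ j) (σ i)
  left_lt_right := h
  above_subset := Set.inter_subset_right

/-- The set `δ(σ)` of the arcs of the descents of `σ`. -/
def descentArcs (σ : Equiv.Perm (Fin n)) : Set (Arc n) :=
  {α | ∃ i j : Fin n, (j : ℕ) = (i : ℕ) + 1 ∧ ∃ h : σ j < σ i, α = arc σ i j h}

/-- The bottom element `π↓(σ)` of the class of `σ` in a congruence of the weak order. -/
noncomputable def projDown (c : LatticeCon (Equiv.Perm (Fin n))) (σ : Equiv.Perm (Fin n)) :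
    Equiv.Perm (Fin n) :=
  open Classical in
  (Finset.univ.filter (fun τ => c.r σ τ)).inf' ⟨σ, by simp⟩ id

theorem isLeast_projDown (c : LatticeCon (Equiv.Perm (Fin n))) (σ : Equiv.Perm (Fin n)) :
    IsLeast {τ | c.r σ τ} (projDown c σ) := by
  classical
  constructor
  · refine Finset.inf'_induction (p := fun τ => c.r σ τ) _ _ ?_ ?_
    · intro τ h τ' h'
      simpa using c.inf h h'
    · intro τ h
      simpa using h
  · intro τ h
    exact Finset.inf'_le (f := id) (by simpa using h)

/-- The set `I` of a congruence: the arcs corresponding to the join-irreducible permutations `σ`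
not contracted by it, where `σ` corresponds to the arc of its unique descent. -/
def uncontractedArcs (c : LatticeCon (Equiv.Perm (Fin n))) : Set (Arc n) :=
  {α | ∃ σ : Equiv.Perm (Fin n), SupIrred σ ∧ projDown c σ = σ ∧ descentArcs σ = {α}}

/-- The noncrossing arc diagram `η(σ) = δ(π↓(σ))` of the congruence class of `σ`. -/
noncomputable def eta (c : LatticeCon (Equiv.Perm (Fin n))) (σ : Equiv.Perm (Fin n)) :
    Set (Arc n) :=
  descentArcs (projDown c σ)

/-- The empty-rectangle inversion pairs: positions `i < j` with `σ i > σ j` such that no position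
strictly between them has its value strictly between `σ j` and `σ i`. -/
def boxes (σ : Equiv.Perm (Fin n)) : Set (Fin n × Fin n) :=
  {p | p.1 < p.2 ∧ σ p.2 < σ p.1 ∧
    σ '' Set.Ioo p.1 p.2 ∩ Set.Ioo (σ p.2) (σ p.1) = ∅}

/-- The (reflexive) order `(i, j) ≺ (k, l)`: `i ≤ k < l ≤ j` and `σ k ≥ σ i > σ j ≥ σ l`. -/
def BoxLE (σ : Equiv.Perm (Fin n)) (p q : Fin n × Fin n) : Prop :=
  p.1 ≤ q.1 ∧ q.1 < q.2 ∧ q.2 ≤ p.2 ∧ σ p.1 ≤ σ q.1 ∧ σ p.2 < σ p.1 ∧ σ q.2 ≤ σ p.2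

/-- The empty-rectangle inversion pairs of `σ` whose arc lies in `I`. -/
def boxesIn (I : Set (Arc n)) (σ : Equiv.Perm (Fin n)) : Set (Fin n × Fin n) :=
  {p | p ∈ boxes σ ∧ ∃ h : σ p.2 < σ p.1, arc σ p.1 p.2 h ∈ I}

/-- The maximal elements of `boxesIn I σ`. -/
def maxBoxesIn (I : Set (Arc n)) (σ : Equiv.Perm (Fin n)) : Set (Fin n × Fin n) :=
  {p | p ∈ boxesIn I σ ∧ ∀ q ∈ boxesIn I σ, BoxLE σ p q → q = p}

end ArcDiagram

namespace ArcDiagram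

variable {n : ℕ}

/-! ### Inversions and descents by values -/

/-! Each arc `α` has a permutation `joinIrred α` whose only descent has arc `α`. It is
join-irreducible, and `α` lies in `I` exactly when `π↓` fixes it. If it is contracted, so is every
interval from `u` up to `joinIrred α ⊔ u`, provided `u` contains all inversions of `joinIrred α`
except its descent (`projDown_le_of_notMem`). Choosing `u` suitably gives both that `I` is an arc
ideal and that the descents of a fixed point of `π↓` have their arcs in `I`.

The formula for `η` rests on a transfer principle: for `α ∈ I`, the arc `α` comes from a box of `σ`
iff it comes from a box of `τ = π↓(σ)` (`IsBoxArc.projDown`, `IsBoxArc.of_projDown`). In `τ` the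
descents dominate all boxes (`IsBoxArc.exists_descent`), and their arcs lie in `I`. Hence the
maximal boxes of `σ` with arc in `I` are those of the descents of `τ` (`mem_eta_iff`). Working with
values instead of positions makes `σ` and `τ` comparable, since `inv τ ⊆ inv σ`. -/

theorem notMem_inv {σ : Equiv.Perm (Fin n)} {a b : Fin n} (h : a < b) :
    (b, a) ∉ inv σ ↔ σ.symm a < σ.symm b := by
  have hne : σ.symm a ≠ σ.symm b := fun e => h.ne (σ.symm.injective e)
  rw [mem_inv, not_and, not_lt]
  exact ⟨fun h' => lt_of_le_of_ne (h' h) hne, fun h' _ => h'.le⟩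

theorem le_iff {σ τ : Equiv.Perm (Fin n)} :
    σ ≤ τ ↔ ∀ y x, (y, x) ∈ inv σ → (y, x) ∈ inv τ :=
  ⟨fun h _ _ hm => h hm, fun h p hm => h p.1 p.2 hm⟩

/-- The stable sort of the values by a key. -/
theorem exists_inv_iff_key (f : Fin n → ℕ) :
    ∃ σ : Equiv.Perm (Fin n), ∀ y x, (y, x) ∈ inv σ ↔ x < y ∧ f y < f x := by
  obtain ⟨σ, h⟩ := exists_inv_eq {p : Fin n × Fin n | p.2 < p.1 ∧ f p.1 < f p.2}
    (fun _ _ h => h.1) (fun _ _ _ h h' => ⟨h'.1.trans h.1, h.2.trans h'.2⟩)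
    (fun a b c hab hbc h => by
      rcases lt_or_ge (f c) (f b) with h1 | h1
      · exact Or.inl ⟨hbc, h1⟩
      · exact Or.inr ⟨hab, h1.trans_lt h.2⟩)
  exact ⟨σ, fun y x => by rw [h]; rfl⟩

/-- The values `b > a` form a descent of `σ`: `a` comes immediately after `b`. -/
def IsDescent (σ : Equiv.Perm (Fin n)) (b a : Fin n) : Prop :=
  (b, a) ∈ inv σ ∧ ∀ z, σ.symm b < σ.symm z → ¬ σ.symm z < σ.symm a

theorem IsDescent.val_succ {σ : Equiv.Perm (Fin n)} {b a : Fin n} (h : IsDescent σ b a) :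
    (σ.symm a : ℕ) = σ.symm b + 1 := by
  have h1 : (σ.symm b : ℕ) < σ.symm a := (mem_inv.1 h.1).2
  by_contra hne
  have h3 := (σ.symm a).isLt
  have h2 := h.2 (σ ⟨σ.symm b + 1, by omega⟩)
  simp only [Equiv.symm_apply_apply, Fin.lt_def] at h2
  exact h2 (by omega) (by omega)

theorem isDescent_iff {σ : Equiv.Perm (Fin n)} {b a : Fin n} :
    IsDescent σ b a ↔ a < b ∧ (σ.symm a : ℕ) = σ.symm b + 1 := by
  refine ⟨fun h => ⟨(mem_inv.1 h.1).1, h.val_succ⟩, fun ⟨h, h'⟩ => ⟨mem_inv.2 ⟨h, ?_⟩, ?_⟩⟩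
  · rw [Fin.lt_def]; omega
  · intro z h1 h2
    rw [Fin.lt_def] at h1 h2
    omega

/-- A permutation below `σ` that contains all descents of `σ` is `σ`. -/
theorem le_of_forall_isDescent {σ τ : Equiv.Perm (Fin n)} (hτ : τ ≤ σ)
    (h : ∀ b a, IsDescent σ b a → (b, a) ∈ inv τ) : σ ≤ τ := by
  rw [le_iff] at hτ ⊢
  -- Induction on the distance in `σ` between the positions of the two inverted values.
  suffices H : ∀ m : ℕ, ∀ y x, (y, x) ∈ inv σ → (σ.symm x : ℕ) - σ.symm y = m → (y, x) ∈ inv τ from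
    fun y x hyx => H _ y x hyx rfl
  intro m
  induction m using Nat.strong_induction_on with
  | _ m ih =>
  intro y x hyx hm
  by_contra hcon
  have hlt := mem_inv.1 hyx
  have ih' : ∀ y' x', (y', x') ∈ inv σ → σ.symm y ≤ σ.symm y' → σ.symm x' ≤ σ.symm x →
      (y' ≠ y ∨ x' ≠ x) → (y', x') ∈ inv τ := by
    intro y' x' h1 h2 h3 h4
    refine ih _ ?_ y' x' h1 rfl
    have h5 := (mem_inv.1 h1).2
    have h6 : σ.symm y' ≠ σ.symm y ∨ σ.symm x' ≠ σ.symm x :=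
      h4.imp (fun h e => h (σ.symm.injective e)) (fun h e => h (σ.symm.injective e))
    rw [ne_eq, ne_eq, Fin.ext_iff, Fin.ext_iff] at h6
    have h7 := hlt.2
    rw [Fin.lt_def] at h5 h7
    rw [Fin.le_def] at h2 h3
    omega
  refine hcon (h y x ⟨hyx, fun z hyz hzx => ?_⟩)
  have hzy : z ≠ y := by rintro rfl; exact lt_irrefl _ hyz
  have hxz : z ≠ x := by rintro rfl; exact lt_irrefl _ hzx
  have hτxy := (notMem_inv hlt.1).1 hcon
  -- A value `z` placed between `y` and `x` splits the inversion by transitivity if `x < z < y`.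
  -- Otherwise the shorter inversion it forms, together with `x` preceding `y` in `τ`, gives an
  -- inversion of `τ` that `σ` lacks.
  rcases lt_or_gt_of_ne hzy with h1 | h1
  · have h2 := ih' y z (mem_inv.2 ⟨h1, hyz⟩) le_rfl hzx.le (Or.inr hxz)
    rcases lt_or_gt_of_ne hxz with h3 | h3
    · have h4 := (mem_inv.1 (hτ x z (mem_inv.2 ⟨h3, hτxy.trans (mem_inv.1 h2).2⟩))).2
      exact lt_asymm h4 hzx
    · exact hcon (inv_trans τ h2 (ih' z x (mem_inv.2 ⟨h3, hzx⟩) hyz.le le_rfl (Or.inl hzy)))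
  · have h2 := ih' z x (mem_inv.2 ⟨hlt.1.trans h1, hzx⟩) hyz.le le_rfl (Or.inl hzy)
    have h4 := (mem_inv.1 (hτ z y (mem_inv.2 ⟨h1, (mem_inv.1 h2).2.trans hτxy⟩))).2
    exact lt_asymm h4 hyz

/-! ### Arcs of boxes -/

/-- `α` is the arc of an empty-rectangle inversion pair of `σ`. -/
structure IsBoxArc (σ : Equiv.Perm (Fin n)) (α : Arc n) : Prop where
  mem : (α.right, α.left) ∈ inv σ
  before : ∀ v ∈ α.above, σ.symm v < σ.symm α.right
  after : ∀ v ∈ Set.Ioo α.left α.right, v ∉ α.above → σ.symm α.left < σ.symm v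

/-- Translates positions into values once and for all. An empty rectangle forces every value in the
open range to come before the right endpoint or after the left one, so the points above the arc are
determined by either condition. -/
theorem exists_eq_arc_iff {σ : Equiv.Perm (Fin n)} {α : Arc n} {P : Fin n → Fin n → Prop}
    (hP : ∀ i j, P i j → (i, j) ∈ boxes σ) :
    (∃ i j, P i j ∧ ∃ h : σ j < σ i, α = arc σ i j h) ↔
      IsBoxArc σ α ∧ P (σ.symm α.right) (σ.symm α.left) := by
  constructor
  · rintro ⟨i, j, hp, h, rfl⟩
    obtain ⟨h1, h2, h3⟩ := hP i j hp
    refine ⟨⟨mem_inv.2 ⟨h, by simpa [arc] using h1⟩, ?_, ?_⟩, by simpa [arc] using hp⟩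
    · rintro v ⟨⟨k, hk, rfl⟩, hv⟩
      simpa [arc] using hk
    · intro v hv hv'
      have h4 : i ≤ σ.symm v := by
        by_contra hcon
        exact hv' ⟨⟨σ.symm v, not_le.1 hcon, by simp⟩, hv⟩
      have h5 : i ≠ σ.symm v := by
        rintro rfl
        simp [arc] at hv
      have h6 : j ≠ σ.symm v := by
        rintro rfl
        simp [arc] at hv
      simp only [arc, Equiv.symm_apply_apply]
      by_contra hcon
      have : v ∈ σ '' Set.Ioo i j ∩ Set.Ioo (σ j) (σ i) :=
        ⟨⟨σ.symm v, ⟨lt_of_le_of_ne h4 h5, lt_of_le_of_ne (not_lt.1 hcon) h6.symm⟩, by simp⟩, hv⟩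
      rw [h3] at this
      exact this
  · rintro ⟨hb, hp⟩
    refine ⟨_, _, hp, by simpa using α.left_lt_right, ?_⟩
    ext v
    · simp [arc]
    · simp [arc]
    · simp only [arc, Equiv.apply_symm_apply]
      constructor
      · intro hv
        exact ⟨⟨σ.symm v, hb.before v hv, by simp⟩, α.above_subset hv⟩
      · rintro ⟨⟨k, hk, rfl⟩, hv⟩
        by_contra hcon
        have h1 := hb.after _ hv hcon
        have h2 := (mem_inv.1 hb.mem).2
        simp only [Equiv.symm_apply_apply] at h1
        exact lt_asymm (hk.trans h2) h1

theorem IsBoxArc.mem_boxes {σ : Equiv.Perm (Fin n)} {α : Arc n} (h : IsBoxArc σ α) :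
    (σ.symm α.right, σ.symm α.left) ∈ boxes σ := by
  refine ⟨(mem_inv.1 h.mem).2, by simpa using α.left_lt_right, ?_⟩
  rw [Set.eq_empty_iff_forall_notMem]
  rintro _ ⟨⟨k, ⟨h1, h2⟩, rfl⟩, h3⟩
  simp only [Equiv.apply_symm_apply] at h3
  by_cases h4 : σ k ∈ α.above
  · have := h.before _ h4
    rw [Equiv.symm_apply_apply] at this
    exact lt_asymm this h1
  · have := h.after _ h3 h4
    rw [Equiv.symm_apply_apply] at this
    exact lt_asymm this h2

theorem mem_descentArcs {σ : Equiv.Perm (Fin n)} {α : Arc n} :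
    α ∈ descentArcs σ ↔ IsBoxArc σ α ∧ IsDescent σ α.right α.left := by
  have := exists_eq_arc_iff (σ := σ) (α := α)
    (P := fun i j => (i, j) ∈ boxes σ ∧ (j : ℕ) = i + 1) (fun _ _ h => h.1)
  rw [isDescent_iff]
  constructor
  · rintro ⟨i, j, hij, h, rfl⟩
    refine ⟨((this.1 ⟨i, j, ⟨⟨by simp only [Fin.lt_def]; omega, h, ?_⟩, hij⟩, h, rfl⟩)).1, h,
      by simpa [arc] using hij⟩
    rw [Set.eq_empty_iff_forall_notMem]
    rintro _ ⟨⟨k, ⟨h1, h2⟩, rfl⟩, -⟩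
    simp only [Fin.lt_def] at h1 h2
    omega
  · rintro ⟨hb, -, hd⟩
    obtain ⟨i, j, hij, h, rfl⟩ := this.2 ⟨hb, hb.mem_boxes, hd⟩
    exact ⟨i, j, hij.2, h, rfl⟩

theorem mem_boxesIn {I : Set (Arc n)} {σ : Equiv.Perm (Fin n)} {i j : Fin n} :
    (i, j) ∈ boxesIn I σ ↔ ∃ α ∈ I, IsBoxArc σ α ∧ σ.symm α.right = i ∧ σ.symm α.left = j := by
  constructor
  · rintro ⟨hb, h, hI⟩
    exact ⟨_, hI, ((exists_eq_arc_iff (P := fun i j => (i, j) ∈ boxes σ) (fun _ _ h => h)).1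
      ⟨i, j, hb, h, rfl⟩).1, by simp [arc], by simp [arc]⟩
  · rintro ⟨α, hI, hb, rfl, rfl⟩
    obtain ⟨i, j, hij, h, rfl⟩ := (exists_eq_arc_iff (P := fun i j => (i, j) ∈ boxes σ)
      (fun _ _ h => h)).2 ⟨hb, hb.mem_boxes⟩
    refine ⟨hb.mem_boxes, by simpa [arc] using h, by simpa [arc] using hI⟩

theorem exists_maxBoxesIn_iff {I : Set (Arc n)} {σ : Equiv.Perm (Fin n)} {α : Arc n} :
    (∃ i j, (i, j) ∈ maxBoxesIn I σ ∧ ∃ h : σ j < σ i, α = arc σ i j h) ↔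
      α ∈ I ∧ IsBoxArc σ α ∧ ∀ β ∈ I, IsBoxArc σ β → σ.symm α.right ≤ σ.symm β.right →
        σ.symm β.left ≤ σ.symm α.left → α.right ≤ β.right → β.left ≤ α.left →
        β.right = α.right ∧ β.left = α.left := by
  constructor
  · intro h
    have hI : α ∈ I := by
      obtain ⟨i, j, hm, h, rfl⟩ := h
      obtain ⟨⟨-, _, hI⟩, -⟩ := hm
      exact hI
    obtain ⟨hb, -, hmax⟩ := (exists_eq_arc_iff fun i j h => h.1.1).1 h
    refine ⟨hI, hb, fun β hβ hbβ h1 h2 h3 h4 => ?_⟩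
    have := hmax (σ.symm β.right, σ.symm β.left) (mem_boxesIn.2 ⟨β, hβ, hbβ, rfl, rfl⟩)
      ⟨h1, (mem_inv.1 hbβ.mem).2, h2, by simpa using h3, by simpa using α.left_lt_right,
        by simpa using h4⟩
    simpa using this
  · rintro ⟨hI, hb, hmax⟩
    refine (exists_eq_arc_iff fun i j h => h.1.1).2 ⟨hb, mem_boxesIn.2 ⟨α, hI, hb, rfl, rfl⟩, ?_⟩
    rintro ⟨i, j⟩ hij ⟨h1, -, h2, h3, -, h4⟩
    obtain ⟨β, hβ, hbβ, rfl, rfl⟩ := mem_boxesIn.1 hij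
    obtain ⟨h5, h6⟩ := hmax β hβ hbβ h1 h2 (by simpa using h3) (by simpa using h4)
    rw [h5, h6]

/-! ### Descents give noncrossing diagrams -/

theorem isNoncrossingArcDiagram_descentArcs (σ : Equiv.Perm (Fin n)) :
    IsNoncrossingArcDiagram (descentArcs σ) := by
  have key : ∀ α β : Arc n, IsDescent σ α.right α.left → IsBoxArc σ β →
      σ.symm α.right < σ.symm β.right →
      ∀ r ∈ (Set.Icc α.left α.right ∩ Set.Icc β.left β.right) \
        ({α.left, α.right} ∩ {β.left, β.right}),
      r ∈ α.above ∪ {α.left, α.right} → r ∉ β.above → IsBoxArc σ α → False := by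
    intro α β hα hβ hlt r hr hrα hrβ hbα
    -- The descent of `α` ends no later than `β` starts. A point where `α` is above `β` would sit
    -- weakly before the first position and weakly after the second, so it is a common endpoint,
    -- which is excluded.
    have h1 : σ.symm α.left ≤ σ.symm β.right := not_lt.1 (hα.2 _ hlt)
    have h2 : σ.symm r ≤ σ.symm α.left := by
      have h0 := (mem_inv.1 hα.1).2
      rcases hrα with h | rfl | rfl
      · exact ((hbα.before r h).trans h0).le
      · exact le_rfl
      · exact h0.le
    have h3 : σ.symm β.right ≤ σ.symm r := by
      have h0 := (mem_inv.1 hβ.mem).2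
      by_cases h : r = β.left
      · exact h ▸ h0.le
      by_cases h' : r = β.right
      · exact h' ▸ le_rfl
      exact (h0.trans (hβ.after r ⟨lt_of_le_of_ne hr.1.2.1 (Ne.symm h),
        lt_of_le_of_ne hr.1.2.2 h'⟩ hrβ)).le
    have h4 : r = α.left := σ.symm.injective (le_antisymm h2 (h1.trans h3))
    have h5 : r = β.right := σ.symm.injective (le_antisymm (h2.trans h1) h3)
    exact hr.2 ⟨Or.inl h4, Or.inr h5⟩
  intro α hα β hβ hne
  have hα' := hα
  have hβ' := hβ
  obtain ⟨i, j, hij, h, rfl⟩ := hα'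
  obtain ⟨k, l, hkl, h', rfl⟩ := hβ'
  have hik : i ≠ k := by
    rintro rfl
    obtain rfl : j = l := Fin.ext (by omega)
    exact hne rfl
  have hjl : j ≠ l := fun e => hik (Fin.ext (by rw [Fin.ext_iff] at e; omega))
  rw [mem_descentArcs] at hα hβ
  refine ⟨?_, fun e => hjl (σ.injective e), fun e => hik (σ.injective e)⟩
  rintro ⟨r, hr, s, hs, hr', hs'⟩
  rcases lt_or_gt_of_ne hik with hlt | hlt
  · exact key _ _ hα.2 hβ.1 (by simpa [arc] using hlt) r hr hr'.1 hr'.2 hα.1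
  · exact key _ _ hβ.2 hα.1 (by simpa [arc] using hlt) s
      (by rwa [Set.inter_comm, Set.inter_comm {_, _}]) hs'.1 hs'.2 hβ.1

/-! ### The join-irreducible permutation of an arc -/

theorem exists_joinIrred (α : Arc n) : ∃ σ : Equiv.Perm (Fin n), ∀ y x, (y, x) ∈ inv σ ↔
    x < y ∧ (y ∈ α.above ∨ y = α.right) ∧
      (x = α.left ∨ x ∈ Set.Ioo α.left α.right ∧ x ∉ α.above) := by
  classical
  -- Two increasing blocks. Values below `α.left` go into the first block so that they create no
  -- inversion.
  obtain ⟨σ, h⟩ := exists_inv_iff_key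
    (fun v => if v < α.left ∨ v ∈ α.above ∨ v = α.right then 0 else 1)
  refine ⟨σ, fun y x => ?_⟩
  rw [h]
  have h1 := α.left_lt_right
  have h2 := fun v hv => α.above_subset (a := v) hv
  simp only [Set.mem_Ioo] at h2 ⊢
  have hy := h2 y
  have hx := h2 x
  split_ifs <;> grind

/-- The join-irreducible permutation with the arc `α`. -/
noncomputable def joinIrred (α : Arc n) : Equiv.Perm (Fin n) := (exists_joinIrred α).choose

theorem mem_inv_joinIrred {α : Arc n} {y x : Fin n} : (y, x) ∈ inv (joinIrred α) ↔
    x < y ∧ (y ∈ α.above ∨ y = α.right) ∧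
      (x = α.left ∨ x ∈ Set.Ioo α.left α.right ∧ x ∉ α.above) :=
  (exists_joinIrred α).choose_spec y x

theorem right_left_mem_inv_joinIrred (α : Arc n) : (α.right, α.left) ∈ inv (joinIrred α) :=
  mem_inv_joinIrred.2 ⟨α.left_lt_right, Or.inr rfl, Or.inl rfl⟩

theorem IsBoxArc.joinIrred_le {σ : Equiv.Perm (Fin n)} {α : Arc n} (h : IsBoxArc σ α) :
    joinIrred α ≤ σ := by
  refine le_iff.2 fun y x hyx => ?_
  obtain ⟨hlt, hy, hx⟩ := mem_inv_joinIrred.1 hyx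
  have h1 : σ.symm y ≤ σ.symm α.right := hy.elim (fun h' => (h.before y h').le) (fun h' => h' ▸ le_rfl)
  have h2 : σ.symm α.left ≤ σ.symm x :=
    hx.elim (fun h' => h' ▸ le_rfl) (fun h' => (h.after x h'.1 h'.2).le)
  exact mem_inv.2 ⟨hlt, h1.trans_lt ((mem_inv.1 h.mem).2.trans_le h2)⟩

theorem isBoxArc_joinIrred (α : Arc n) : IsBoxArc (joinIrred α) α := by
  have h1 := right_left_mem_inv_joinIrred α
  refine ⟨h1, fun v hv => ?_, fun v hv hv' => ?_⟩
  · have h2 := α.above_subset hv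
    refine (notMem_inv h2.2).1 fun h => ?_
    rcases (mem_inv_joinIrred.1 h).2.2 with h | h
    · exact h2.1.ne' h
    · exact h.2 hv
  · refine (notMem_inv hv.1).1 fun h => ?_
    rcases (mem_inv_joinIrred.1 h).2.1 with h | h
    · exact hv' h
    · exact hv.2.ne h

theorem IsDescent.eq_of_joinIrred {α : Arc n} {b a : Fin n} (h : IsDescent (joinIrred α) b a) :
    b = α.right ∧ a = α.left := by
  obtain ⟨hlt, hb, ha⟩ := mem_inv_joinIrred.1 h.1
  have hbox := isBoxArc_joinIrred α
  have h0 := (mem_inv.1 hbox.mem).2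
  have h1 : (joinIrred α).symm α.left ≤ (joinIrred α).symm a :=
    ha.elim (fun h' => h' ▸ le_rfl) (fun h' => (hbox.after a h'.1 h'.2).le)
  have h2 : (joinIrred α).symm b ≤ (joinIrred α).symm α.right :=
    hb.elim (fun h' => (hbox.before b h').le) (fun h' => h' ▸ le_rfl)
  constructor
  · refine hb.resolve_left fun hb => ?_
    exact h.2 _ (hbox.before b hb) (h0.trans_le h1)
  · refine ha.resolve_right fun ha => ?_
    exact h.2 _ (h2.trans_lt h0) (hbox.after a ha.1 ha.2)

theorem joinIrred_le_of_mem {α : Arc n} {τ : Equiv.Perm (Fin n)} (h : τ ≤ joinIrred α)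
    (hm : (α.right, α.left) ∈ inv τ) : joinIrred α ≤ τ := by
  refine le_of_forall_isDescent h fun b a hba => ?_
  obtain ⟨rfl, rfl⟩ := hba.eq_of_joinIrred
  exact hm

/-- The permutation obtained by undoing a descent. -/
theorem IsDescent.exists_undo {σ : Equiv.Perm (Fin n)} {b a : Fin n} (h : IsDescent σ b a) :
    ∃ τ : Equiv.Perm (Fin n), ∀ y x, (y, x) ∈ inv τ ↔ (y, x) ∈ inv σ ∧ ¬ (y = b ∧ x = a) := by
  obtain ⟨hlt, hpos⟩ := isDescent_iff.1 h
  -- With equal keys, stability puts `a` before `b`. No value lies between them in position, so no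
  -- other comparison changes.
  obtain ⟨τ, hτ⟩ := exists_inv_iff_key
    (fun v => if v = a then (σ.symm b : ℕ) else σ.symm v)
  refine ⟨τ, fun y x => ?_⟩
  rw [hτ, mem_inv, and_assoc]
  refine and_congr_right fun hxy => ?_
  have hb : ∀ v : Fin n, (σ.symm v : ℕ) = σ.symm b → v = b :=
    fun v e => σ.symm.injective (Fin.ext e)
  have ha : ∀ v : Fin n, (σ.symm v : ℕ) = σ.symm a → v = a :=
    fun v e => σ.symm.injective (Fin.ext e)
  rw [Fin.lt_def]
  have := hb y
  have := hb x
  have := ha y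
  have := ha x
  split_ifs <;> grind

theorem isDescent_joinIrred (α : Arc n) : IsDescent (joinIrred α) α.right α.left := by
  by_contra hcon
  -- Without descents `joinIrred α` would lie below the identity (the constant key), yet it has an
  -- inversion.
  obtain ⟨b, a, hba⟩ : ∃ b a, IsDescent (joinIrred α) b a := by
    by_contra! hno
    obtain ⟨τ, hτ⟩ := exists_inv_iff_key (fun _ : Fin n => 0)
    have := le_iff.1 (le_of_forall_isDescent (τ := τ) (le_iff.2 fun y x h => by simp [hτ] at h)
      fun b a h => absurd h (hno b a)) _ _ (right_left_mem_inv_joinIrred α)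
    simp [hτ] at this
  obtain ⟨rfl, rfl⟩ := hba.eq_of_joinIrred
  exact hcon hba

theorem descentArcs_joinIrred (α : Arc n) : descentArcs (joinIrred α) = {α} := by
  ext β
  rw [mem_descentArcs, Set.mem_singleton_iff]
  constructor
  · rintro ⟨hβ, hd⟩
    obtain ⟨h1, h2⟩ := hd.eq_of_joinIrred
    have hα := isBoxArc_joinIrred α
    have h0 := (mem_inv.1 hα.mem).2
    -- Two box arcs of one permutation with the same endpoints coincide: a point on different sides
    -- would be both before the right endpoint and after the left one.
    ext v
    · rw [h2]
    · rw [h1]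
    · constructor
      · intro hv
        by_contra hv'
        have h3 := hβ.before v hv
        have h4 := hα.after v (by simpa only [h1, h2] using β.above_subset hv) hv'
        rw [h1] at h3
        exact lt_asymm h3 (h0.trans h4)
      · intro hv
        by_contra hv'
        have h3 := hα.before v hv
        have h4 := hβ.after v (by simpa only [h1, h2] using α.above_subset hv) hv'
        rw [h2] at h4
        exact lt_asymm h3 (h0.trans h4)
  · rintro rfl
    exact ⟨isBoxArc_joinIrred β, isDescent_joinIrred β⟩

theorem eq_joinIrred_of_descentArcs {σ : Equiv.Perm (Fin n)} {α : Arc n}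
    (h : descentArcs σ = {α}) : σ = joinIrred α := by
  have h0 : α ∈ descentArcs σ := h ▸ rfl
  have hle := (mem_descentArcs.1 h0).1.joinIrred_le
  refine le_antisymm (le_of_forall_isDescent hle fun b a hba => ?_) hle
  obtain ⟨hlt, hpos⟩ := isDescent_iff.1 hba
  have h1 : arc σ (σ.symm b) (σ.symm a) (by simpa using hlt) ∈ descentArcs σ :=
    ⟨_, _, hpos, by simpa using hlt, rfl⟩
  rw [h, Set.mem_singleton_iff] at h1
  subst h1
  simpa [arc] using right_left_mem_inv_joinIrred (arc σ (σ.symm b) (σ.symm a) (by simpa using hlt))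

/-- Undoing the only descent gives `u`, and everything strictly below `joinIrred α` is below `u`; so
a join of two smaller elements stays below `u`. -/
theorem supIrred_joinIrred (α : Arc n) : SupIrred (joinIrred α) := by
  obtain ⟨u, hu⟩ := (isDescent_joinIrred α).exists_undo
  have hm := right_left_mem_inv_joinIrred α
  have hlt : ∀ τ : Equiv.Perm (Fin n), τ ≤ joinIrred α → τ = joinIrred α ∨ τ ≤ u := by
    intro τ hτ
    by_cases h : (α.right, α.left) ∈ inv τ
    · exact Or.inl (le_antisymm hτ (joinIrred_le_of_mem hτ h))
    · refine Or.inr (le_iff.2 fun y x hyx => (hu y x).2 ⟨le_iff.1 hτ y x hyx, ?_⟩)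
      rintro ⟨rfl, rfl⟩
      exact h hyx
  have hnle : ¬ joinIrred α ≤ u := fun h => ((hu _ _).1 (le_iff.1 h _ _ hm)).2 ⟨rfl, rfl⟩
  refine ⟨fun hmin => hnle (hmin (le_iff.2 fun y x h => ((hu y x).1 h).1)), fun {τ ρ} h => ?_⟩
  rcases hlt τ (h ▸ le_sup_left) with h1 | h1
  · exact Or.inl h1
  rcases hlt ρ (h ▸ le_sup_right) with h2 | h2
  · exact Or.inr h2
  exact absurd (h ▸ sup_le h1 h2) hnle

/-! ### Congruences -/

variable {c : LatticeCon (Equiv.Perm (Fin n))}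

theorem rel_projDown (c : LatticeCon (Equiv.Perm (Fin n))) (σ : Equiv.Perm (Fin n)) :
    c.r σ (projDown c σ) := (isLeast_projDown c σ).1

theorem projDown_le (c : LatticeCon (Equiv.Perm (Fin n))) (σ : Equiv.Perm (Fin n)) :
    projDown c σ ≤ σ := (isLeast_projDown c σ).2 (c.refl σ)

theorem projDown_mono {σ τ : Equiv.Perm (Fin n)} (h : σ ≤ τ) : projDown c σ ≤ projDown c τ := by
  have h1 := c.inf (rel_projDown c σ) (rel_projDown c τ)
  rw [inf_eq_left.2 h] at h1
  exact ((isLeast_projDown c σ).2 h1).trans inf_le_right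

theorem projDown_projDown (σ : Equiv.Perm (Fin n)) :
    projDown c (projDown c σ) = projDown c σ :=
  le_antisymm (projDown_le c _)
    ((isLeast_projDown c σ).2 (c.trans (rel_projDown c σ) (rel_projDown c _)))

theorem mem_uncontractedArcs {α : Arc n} :
    α ∈ uncontractedArcs c ↔ projDown c (joinIrred α) = joinIrred α := by
  constructor
  · rintro ⟨σ, -, h, hα⟩
    rwa [← eq_joinIrred_of_descentArcs hα]
  · exact fun h => ⟨_, supIrred_joinIrred α, h, descentArcs_joinIrred α⟩

theorem joinIrred_le_projDown {α : Arc n} (hα : α ∈ uncontractedArcs c) {σ : Equiv.Perm (Fin n)}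
    (h : joinIrred α ≤ σ) : joinIrred α ≤ projDown c σ :=
  (mem_uncontractedArcs.1 hα) ▸ projDown_mono h

/-- Contracting the arc `α` contracts everything between `u` and `joinIrred α ⊔ u`, when the
descent of `joinIrred α` is its only inversion that is not in `u`. -/
theorem projDown_le_of_notMem {α : Arc n} (hα : α ∉ uncontractedArcs c)
    {u w : Equiv.Perm (Fin n)}
    (hu : ∀ y x, (y, x) ∈ inv (joinIrred α) → ¬ (y = α.right ∧ x = α.left) → (y, x) ∈ inv u)
    (hw : w ≤ joinIrred α ⊔ u) : projDown c w ≤ u := by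
  -- The projection must lose the descent: an element below `joinIrred α` that keeps it is
  -- `joinIrred α` itself.
  have h1 : projDown c (joinIrred α) ≤ u := by
    refine le_iff.2 fun y x hyx => hu y x (le_iff.1 (projDown_le c _) y x hyx) ?_
    rintro ⟨rfl, rfl⟩
    exact hα (mem_uncontractedArcs.2
      (le_antisymm (projDown_le c _) (joinIrred_le_of_mem (projDown_le c _) hyx)))
  -- Joining with `u` gives `joinIrred α ⊔ u ≡ u`; meeting with `w` then gives `w ≡ w ⊓ u`.
  have h2 := c.sup (rel_projDown c (joinIrred α)) (c.refl u)
  have h3 := c.inf (c.refl w) h2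
  rw [inf_eq_left.2 hw, sup_eq_right.2 h1] at h3
  exact ((isLeast_projDown c w).2 h3).trans inf_le_right

/-- If the restriction `β` were contracted, it would force the contraction of `α`. The witness `u`
contains all of `joinIrred β` but its descent and lacks the descent of `α`, while adding the descent
of `β` recovers all of `joinIrred α`. -/
theorem isArcIdeal_uncontractedArcs (c : LatticeCon (Equiv.Perm (Fin n))) :
    IsArcIdeal (uncontractedArcs c) := by
  classical
  intro α hα β hl hr hab
  by_contra hβ
  have h1 := α.left_lt_right
  have h2 := β.left_lt_right
  have hαs := fun v hv => α.above_subset (a := v) hv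
  simp only [Set.mem_Ioo] at hαs
  -- The keys list the other points above `α`, then `β.left`, `α.left`, `α.right`, `β.right`, then
  -- the rest. So `u` inverts `β.left` with `α.left` and `α.right` with `β.right` whenever they
  -- differ, but not `α.right` with `α.left`. The conditions allow for shared endpoints.
  obtain ⟨f, hfa, hfd, hfb, hfc, hfS, hfQ⟩ : ∃ f : Fin n → ℕ, f α.left = 2 ∧ f α.right = 3 ∧
      (β.left ≠ α.left → f β.left = 1) ∧ (β.right ≠ α.right → f β.right = 4) ∧
      (∀ v ∈ α.above, v ≠ β.left → v ≠ β.right → f v = 0) ∧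
      (∀ v ∉ α.above, v ≠ α.left → v ≠ α.right → v ≠ β.left → v ≠ β.right → f v = 5) := by
    refine ⟨fun v => if v = α.left then 2 else if v = α.right then 3 else if v = β.left then 1
      else if v = β.right then 4 else if v ∈ α.above then 0 else 5, ?_, ?_, ?_, ?_, ?_, ?_⟩
    · simp
    · simp [h1.ne']
    · intro h
      simp [h, (h2.trans_le hr).ne]
    · intro h
      simp [h, (hl.trans_lt h2).ne', h2.ne']
    · intro v hv hb hc
      simp [hv, hb, hc, (hαs v hv).1.ne', (hαs v hv).2.ne]
    · intro v hv ha hd hb hc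
      simp [hv, ha, hd, hb, hc]
  obtain ⟨u, hu⟩ := exists_inv_iff_key f
  have hab' : ∀ v, v ∈ β.above ↔ v ∈ α.above ∧ β.left < v ∧ v < β.right := by
    intro v; rw [hab]; rfl
  have hfb' : f β.left ≤ 2 := by
    by_cases h : β.left = α.left
    · rw [h, hfa]
    · rw [hfb h]; omega
  have hfc' : 3 ≤ f β.right := by
    by_cases h : β.right = α.right
    · rw [h, hfd]
    · rw [hfc h]; omega
  have hb0 : 0 < f β.left := by
    by_cases h : β.left = α.left
    · rw [h, hfa]; omega
    · rw [hfb h]; omega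
  have hc5 : f β.right < 5 := by
    by_cases h : β.right = α.right
    · rw [h, hfd]; omega
    · rw [hfc h]; omega
  have h3 : projDown c (joinIrred α) ≤ u := by
    refine projDown_le_of_notMem hβ (fun y x hyx hne => ?_) (le_iff.2 fun y x hyx => ?_)
    · rw [mem_inv_joinIrred, Set.mem_Ioo, hab', hab'] at hyx
      obtain ⟨hlt, hy, hx⟩ := hyx
      refine (hu y x).2 ⟨hlt, ?_⟩
      have hy' : (y = β.right ∧ f y < 5) ∨ f y = 0 := hy.elim
        (fun h => Or.inr (hfS y h.1 h.2.1.ne' h.2.2.ne)) (fun h => Or.inl ⟨h, h ▸ hc5⟩)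
      have hx' : (x = β.left ∧ 0 < f x) ∨ f x = 5 := hx.elim
        (fun h => Or.inl ⟨h, h ▸ hb0⟩) (fun h => Or.inr (hfQ x (fun h' => h.2 ⟨h', h.1⟩)
          (hl.trans_lt h.1.1).ne' (h.1.2.trans_le hr).ne h.1.1.ne' h.1.2.ne))
      rcases hy' with ⟨hy1, hy2⟩ | hy' <;> rcases hx' with ⟨hx1, hx2⟩ | hx'
      · exact absurd ⟨hy1, hx1⟩ hne
      all_goals omega
    · have h5 : ∀ y x, (y, x) ∈ inv u → (y, x) ∈ inv (joinIrred β ⊔ u) :=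
        le_iff.1 le_sup_right
      have h6 : (β.right, β.left) ∈ inv (joinIrred β ⊔ u) :=
        le_iff.1 le_sup_left _ _ (right_left_mem_inv_joinIrred β)
      have h7 : β.left = α.left ∨ (β.left, α.left) ∈ inv (joinIrred β ⊔ u) := by
        by_cases h : β.left = α.left
        · exact Or.inl h
        · exact Or.inr (h5 _ _ ((hu _ _).2 ⟨lt_of_le_of_ne hl (Ne.symm h),
            by rw [hfb h, hfa]; omega⟩))
      have h8 : β.right = α.right ∨ (α.right, β.right) ∈ inv (joinIrred β ⊔ u) := by
        by_cases h : β.right = α.right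
        · exact Or.inl h
        · exact Or.inr (h5 _ _ ((hu _ _).2 ⟨lt_of_le_of_ne hr h, by rw [hfc h, hfd]; omega⟩))
      -- The descent of `β` links the two inversions of `u`: transitivity along `α.right`,
      -- `β.right`, `β.left`, `α.left` yields the descent of `α`.
      have h9 : (β.right, α.left) ∈ inv (joinIrred β ⊔ u) :=
        h7.elim (fun h => h ▸ h6) (fun h => inv_trans _ h6 h)
      have h10 : (α.right, β.left) ∈ inv (joinIrred β ⊔ u) :=
        h8.elim (fun h => h ▸ h6) (fun h => inv_trans _ h h6)
      have h11 : (α.right, α.left) ∈ inv (joinIrred β ⊔ u) :=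
        h8.elim (fun h => h ▸ h9) (fun h => inv_trans _ h h9)
      by_cases hyx' : (y, x) ∈ inv u
      · exact h5 _ _ hyx'
      rw [mem_inv_joinIrred, Set.mem_Ioo] at hyx
      rw [hu] at hyx'
      obtain ⟨hlt, hy0, hx0⟩ := hyx
      -- Inversions of `joinIrred α` missing from `u` can only involve the endpoints of the two
      -- arcs, because other points have the extreme keys 0 and 5.
      have hy : y = β.right ∨ y = α.right ∨ y = β.left := by
        by_contra! hy
        have hy1 := hfS y (hy0.resolve_right hy.2.1) hy.2.2 hy.1
        refine hyx' ⟨hlt, ?_⟩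
        rw [hy1]
        by_cases hxb : x = β.left
        · exact hxb ▸ hb0
        by_cases hxc : x = β.right
        · exact hxc ▸ (by omega)
        rcases hx0 with rfl | hx0
        · omega
        · rw [hfQ x hx0.2 hx0.1.1.ne' hx0.1.2.ne hxb hxc]
          omega
      have hx : x = α.left ∨ x = β.left ∨ x = β.right := by
        by_contra! hx
        have hx' := hx0.resolve_left hx.1
        refine hyx' ⟨hlt, ?_⟩
        rw [hfQ x hx'.2 hx.1 hx'.1.2.ne hx.2.1 hx.2.2]
        rcases hy with rfl | rfl | rfl <;> omega
      rcases hy with rfl | rfl | rfl <;> rcases hx with rfl | rfl | rfl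
      · exact h9
      · exact h6
      · exact absurd hlt (lt_irrefl _)
      · exact h11
      · exact h10
      · exact h8.resolve_left hlt.ne
      · exact h7.resolve_left hlt.ne'
      · exact absurd hlt (lt_irrefl _)
      · exact absurd hlt (lt_asymm h2)
  rw [mem_uncontractedArcs.1 hα] at h3
  have h4 := ((hu _ _).1 (le_iff.1 h3 _ _ (right_left_mem_inv_joinIrred α))).2
  omega

theorem descentArcs_subset_uncontractedArcs {τ : Equiv.Perm (Fin n)} (hτ : projDown c τ = τ) :
    descentArcs τ ⊆ uncontractedArcs c := by
  intro α hα
  obtain ⟨hb, hd⟩ := mem_descentArcs.1 hα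
  by_contra hcon
  obtain ⟨u, hu⟩ := hd.exists_undo
  have h := projDown_le_of_notMem (u := u) (w := τ) hcon
    (fun y x h h' => (hu y x).2 ⟨le_iff.1 hb.joinIrred_le y x h, h'⟩)
    (le_iff.2 fun y x hyx => by
      by_cases h : y = α.right ∧ x = α.left
      · obtain ⟨rfl, rfl⟩ := h
        exact le_iff.1 le_sup_left _ _ (right_left_mem_inv_joinIrred α)
      · exact le_iff.1 le_sup_right _ _ ((hu y x).2 ⟨hyx, h⟩))
  rw [hτ] at h
  exact ((hu _ _).1 (le_iff.1 h _ _ hd.1)).2 ⟨rfl, rfl⟩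

/-! ### Transfer of boxes between a permutation and its projection -/

theorem IsBoxArc.projDown {α : Arc n} (hα : α ∈ uncontractedArcs c) {σ : Equiv.Perm (Fin n)}
    (h : IsBoxArc σ α) : IsBoxArc (projDown c σ) α := by
  have hle := le_iff.1 (projDown_le c σ)
  have h1 := le_iff.1 (joinIrred_le_projDown hα h.joinIrred_le)
  refine ⟨h1 _ _ (right_left_mem_inv_joinIrred α), fun v hv => ?_, fun v hv hv' => ?_⟩
  · refine (notMem_inv (α.above_subset hv).2).1 fun hm => ?_
    exact lt_asymm (mem_inv.1 (hle _ _ hm)).2 (h.before v hv)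
  · refine (notMem_inv hv.1).1 fun hm => ?_
    exact lt_asymm (mem_inv.1 (hle _ _ hm)).2 (h.after v hv hv')

/-- A point on the wrong side in `σ` cuts off a restriction `β` of `α`, which is in `I` by the ideal
property. For an extremal such point `joinIrred β ≤ σ`, so `π↓(σ)` also has the inversion of the
endpoints of `β`, contradicting the box there. -/
theorem IsBoxArc.of_projDown {α : Arc n} (hα : α ∈ uncontractedArcs c) {σ : Equiv.Perm (Fin n)}
    (h : IsBoxArc (ArcDiagram.projDown c σ) α) : IsBoxArc σ α := by
  have hle := le_iff.1 (projDown_le c σ)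
  have hlt := (mem_inv.1 h.mem).2
  have hj : ∀ y x, (y, x) ∈ inv (joinIrred α) → (y, x) ∈ inv σ :=
    fun y x hyx => hle y x (le_iff.1 h.joinIrred_le y x hyx)
  refine ⟨hle _ _ h.mem, ?_, ?_⟩
  · by_contra! hcon
    -- the greatest value above the arc that comes after the right endpoint
    obtain ⟨z, ⟨hz, hbz⟩, hmax⟩ := (Set.toFinite
      {v | v ∈ α.above ∧ σ.symm α.right ≤ σ.symm v}).exists_maximal hcon
    have hzI := α.above_subset hz
    let β : Arc n := ⟨z, α.right, α.above ∩ Set.Ioo z α.right, hzI.2, Set.inter_subset_right⟩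
    have hβ : β ∈ uncontractedArcs c :=
      isArcIdeal_uncontractedArcs c α hα β hzI.1.le le_rfl rfl
    have hzb : σ.symm α.right < σ.symm z :=
      lt_of_le_of_ne hbz fun e => hzI.2.ne (σ.symm.injective e).symm
    have hjβ : joinIrred β ≤ σ := by
      refine le_iff.2 fun y x hyx => ?_
      obtain ⟨hxy, hy, hx⟩ := mem_inv_joinIrred.1 hyx
      -- Inversions ending in `z` come from its maximality; the others are already inversions of
      -- `joinIrred α`.
      rcases hx with rfl | ⟨hx, hx'⟩
      · refine mem_inv.2 ⟨hxy, ?_⟩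
        rcases hy with hy | rfl
        · by_contra hy'
          exact hxy.not_ge (hmax ⟨hy.1, hbz.trans (not_lt.1 hy')⟩ hxy.le)
        · exact hzb
      · exact hj y x (mem_inv_joinIrred.2 ⟨hxy, hy.imp_left fun h' => h'.1,
          Or.inr ⟨⟨hzI.1.trans hx.1, hx.2⟩, fun h' => hx' ⟨h', hx⟩⟩⟩)
    have h1 := le_iff.1 (joinIrred_le_projDown hβ hjβ) _ _ (right_left_mem_inv_joinIrred β)
    exact lt_asymm (mem_inv.1 h1).2 (h.before z hz)
  · by_contra! hcon
    -- the least value below the arc that comes before the left endpoint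
    obtain ⟨z, ⟨hzI, hz, hza⟩, hmin⟩ := (Set.toFinite {v | v ∈ Set.Ioo α.left α.right ∧
      v ∉ α.above ∧ σ.symm v ≤ σ.symm α.left}).exists_minimal hcon
    let β : Arc n := ⟨α.left, z, α.above ∩ Set.Ioo α.left z, hzI.1, Set.inter_subset_right⟩
    have hβ : β ∈ uncontractedArcs c :=
      isArcIdeal_uncontractedArcs c α hα β le_rfl hzI.2.le rfl
    have hza' : σ.symm z < σ.symm α.left :=
      lt_of_le_of_ne hza fun e => hzI.1.ne (σ.symm.injective e).symm
    have hjβ : joinIrred β ≤ σ := by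
      refine le_iff.2 fun y x hyx => ?_
      obtain ⟨hxy, hy, hx⟩ := mem_inv_joinIrred.1 hyx
      rcases hy with hy | rfl
      · exact hj y x (mem_inv_joinIrred.2 ⟨hxy, Or.inl hy.1, hx.imp_right fun h' =>
          ⟨⟨h'.1.1, h'.1.2.trans hzI.2⟩, fun h'' => h'.2 ⟨h'', h'.1⟩⟩⟩)
      · refine mem_inv.2 ⟨hxy, ?_⟩
        rcases hx with rfl | ⟨hx, hx'⟩
        · exact hza'
        · by_contra hx''
          exact hxy.not_ge (hmin ⟨⟨hx.1, hx.2.trans hzI.2⟩, fun h' => hx' ⟨h', hx⟩,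
            (not_lt.1 hx'').trans hza⟩ hxy.le)
    have h1 := le_iff.1 (joinIrred_le_projDown hβ hjβ) _ _ (right_left_mem_inv_joinIrred β)
    exact lt_asymm (mem_inv.1 h1).2 (h.after z hzI hz)

/-- Between the positions of a box there is a descent whose value range contains that of the box. -/
theorem IsBoxArc.exists_descent {τ : Equiv.Perm (Fin n)} {α : Arc n} (h : IsBoxArc τ α) :
    ∃ β ∈ descentArcs τ, τ.symm α.right ≤ τ.symm β.right ∧ τ.symm β.left ≤ τ.symm α.left ∧
      α.right ≤ β.right ∧ β.left ≤ α.left := by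
  -- At the first position after `α.right` whose value is at most `α.left`, the preceding value
  -- cannot lie inside the empty rectangle, so it is at least `α.right`.
  obtain ⟨j, ⟨hj1, hj2⟩, hmin⟩ := (Set.toFinite
    {j | τ.symm α.right < j ∧ τ j ≤ α.left}).exists_minimal
      ⟨τ.symm α.left, (mem_inv.1 h.mem).2, by simp⟩
  have hjle : j ≤ τ.symm α.left := by
    by_contra! hlt
    exact hlt.not_ge (hmin ⟨(mem_inv.1 h.mem).2, by simp⟩ hlt.le)
  have hj0 : (τ.symm α.right : ℕ) < j := hj1
  let i : Fin n := ⟨j - 1, by omega⟩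
  have hij : (j : ℕ) = i + 1 := by simp only [i]; omega
  have hbi : τ.symm α.right ≤ i := by rw [Fin.le_def]; omega
  have hi : α.right ≤ τ i := by
    rcases hbi.eq_or_lt with h1 | h1
    · rw [← h1]; simp
    by_contra! hcon
    have h2 : i < τ.symm α.left := by
      rw [Fin.le_def] at hjle
      rw [Fin.lt_def]; omega
    have h3 : α.left < τ i := by
      by_contra! h3
      have := hmin ⟨h1, h3⟩ (by rw [Fin.le_def]; omega)
      rw [Fin.le_def] at this
      omega
    by_cases h4 : τ i ∈ α.above
    · have := h.before _ h4
      rw [Equiv.symm_apply_apply] at this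
      exact lt_asymm h1 this
    · have := h.after _ ⟨h3, hcon⟩ h4
      rw [Equiv.symm_apply_apply] at this
      exact lt_asymm h2 this
  have hlt : τ j < τ i := hj2.trans_lt (α.left_lt_right.trans_le hi)
  exact ⟨arc τ i j hlt, ⟨i, j, hij, hlt, rfl⟩, by simpa [arc] using hbi, by simpa [arc] using hjle,
    hi, hj2⟩

theorem mem_eta_iff {σ : Equiv.Perm (Fin n)} {α : Arc n} :
    α ∈ eta c σ ↔ α ∈ uncontractedArcs c ∧ IsBoxArc σ α ∧
      ∀ β ∈ uncontractedArcs c, IsBoxArc σ β → σ.symm α.right ≤ σ.symm β.right →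
        σ.symm β.left ≤ σ.symm α.left → α.right ≤ β.right → β.left ≤ α.left →
        β.right = α.right ∧ β.left = α.left := by
  have hsub : eta c σ ⊆ uncontractedArcs c :=
    descentArcs_subset_uncontractedArcs (projDown_projDown σ)
  have hle := le_iff.1 (projDown_le c σ)
  constructor
  · intro hα
    obtain ⟨hb, hd⟩ := mem_descentArcs.1 hα
    refine ⟨hsub hα, hb.of_projDown (hsub hα), fun β hβ hbβ h1 h2 h3 h4 => ?_⟩
    have hβ' := (mem_inv.1 (hbβ.projDown hβ).mem).2
    have h5 : β.left < α.left → (projDown c σ).symm α.left < (projDown c σ).symm β.left → False :=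
      fun h h' => h2.not_gt (mem_inv.1 (hle _ _ (mem_inv.2 ⟨h, h'⟩))).2
    have hright : β.right = α.right := by
      -- If `β.right` were larger, it would come after the whole descent of `α` in the projection.
      -- Then `β.left` comes after `α.left` there, which contradicts their order in `σ`.
      by_contra hne
      have hlt := lt_of_le_of_ne h3 (Ne.symm hne)
      have h6 : (projDown c σ).symm α.right < (projDown c σ).symm β.right := by
        refine (notMem_inv hlt).1 fun hm => ?_
        exact h1.not_gt (mem_inv.1 (hle _ _ hm)).2
      have h7 := not_lt.1 (hd.2 _ h6)
      rcases h4.eq_or_lt with h8 | h8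
      · exact (h7.trans_lt hβ').ne (by rw [h8])
      · exact h5 h8 (h7.trans_lt hβ')
    refine ⟨hright, ?_⟩
    by_contra hne
    have hlt := lt_of_le_of_ne h4 hne
    rw [hright] at hβ'
    exact h5 hlt (lt_of_le_of_ne (not_lt.1 (hd.2 _ hβ'))
      fun e => hne ((projDown c σ).symm.injective e).symm)
  · rintro ⟨hα, hb, hmax⟩
    have hbτ := hb.projDown hα
    obtain ⟨β, hβ, h1, h2, h3, h4⟩ := hbτ.exists_descent
    have hβ' := mem_descentArcs.1 hβ
    have hβσ := hβ'.1.of_projDown (hsub hβ)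
    have hlt := (mem_inv.1 hbτ.mem).2
    have hltβ := (mem_inv.1 hβ'.1.mem).2
    -- The position bounds from `exists_descent` hold in the projection. They carry over to `σ`
    -- because they fix the side of `β` on which the endpoints of `α` lie, and `β` is a box arc of
    -- `σ` too.
    obtain ⟨h5, h6⟩ := hmax β (hsub hβ) hβσ
      (by
        rcases h3.eq_or_lt with h | h
        · rw [h]
        refine (hβσ.before _ ?_).le
        by_contra hcon
        exact ((hβ'.1.after _ ⟨h4.trans_lt α.left_lt_right, h⟩ hcon).trans_le h1).not_gt hltβ)
      (by
        rcases h4.eq_or_lt with h | h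
        · rw [h]
        refine (hβσ.after _ ⟨h, α.left_lt_right.trans_le h3⟩ fun hcon => ?_).le
        exact (h2.trans_lt (hβ'.1.before _ hcon)).not_gt hltβ) h3 h4
    exact mem_descentArcs.2 ⟨hbτ, h5 ▸ h6 ▸ hβ'.2⟩

end ArcDiagram

theorem mainTheorem3 (n : ℕ) (c : LatticeCon (Equiv.Perm (Fin n))) :
    ArcDiagram.IsArcIdeal (ArcDiagram.uncontractedArcs c) ∧
    ∀ σ : Equiv.Perm (Fin n),
      ArcDiagram.eta c σ =
        {α | ∃ i j : Fin n, (i, j) ∈ ArcDiagram.maxBoxesIn (ArcDiagram.uncontractedArcs c) σ ∧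
          ∃ h : σ j < σ i, α = ArcDiagram.arc σ i j h} ∧
      ArcDiagram.IsNoncrossingArcDiagram (ArcDiagram.eta c σ) ∧
      ArcDiagram.eta c σ ⊆ ArcDiagram.uncontractedArcs c := by
  refine ⟨ArcDiagram.isArcIdeal_uncontractedArcs c, fun σ => ⟨?_, ?_, ?_⟩⟩
  · ext α
    exact ArcDiagram.mem_eta_iff.trans ArcDiagram.exists_maxBoxesIn_iff.symm
  · exact ArcDiagram.isNoncrossingArcDiagram_descentArcs _
  · exact ArcDiagram.descentArcs_subset_uncontractedArcs (ArcDiagram.projDown_projDown σ)
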